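/- Let $d\ge 1$. A finite set $S\subset\mathbb{R}^d$ is in general position if any at most $d+1$ of its points are affinely independent. The random hyperplane search tree on such a set $S$ is the random binary tree built as follows. If $|S|\ge d$, choose $d$ points of $S$ uniformly at random without replacement; these pivots are stored at the root, and the points of $S$ lying strictly on either side of the hyperplane through the pivots are handled recursively and independently, giving the two subtrees. If $|S|<d$, the tree is a single leaf storing all points of $S$. The depth of a data point is the number of edges from the root to the node storing it. Let $\overline{D}(S)$ be the mean of the depths of all points of $S$ (a random variable depending on the tree), and let $D(S)$ be the depth of a point drawn uniformly at random from $S$, independently of the tree. Proposition. There are constants $C(d)$, $d\ge 1$, such that for every fixed $d\ge1$ and every $\varepsilon>0$, $$\lim_{n\to\infty}\ \sup_{S}\ \mathbb{P}\bigl(\overline{D}(S)\ge (C(d)+\varepsilon)\log_2 n\bigr)=0 \qquad\text{and}\qquad \lim_{n\to\infty}\ \sup_{S}\ \mathbb{P}\bigl(D(S)\ge (C(d)+\varepsilon)\log_2 n\bigr)=0,$$ where the suprema run over all $n$-point sets $S\subset\mathbb{R}^d$ in general position. Furthermore, as $d\to\infty$, $$C(d)=1+O\!\left(\frac{\log d}{d}\right).$$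 -/

import Mathlib

open Filter Topology Asymptotics

/-- A finite set of points of `ℝ^d` is in general position if any at most `d + 1` of its points are
affinely independent (no three on a line, no four on a plane, ..., no `d + 1` on a hyperplane). -/
def InGeneralPosition {d : ℕ} (S : Finset (EuclideanSpace ℝ (Fin d))) : Prop :=
  ∀ T ⊆ S, T.card ≤ d + 1 →
    AffineIndependent ℝ (fun x : T => (x : EuclideanSpace ℝ (Fin d)))

/-- `d` affinely independent points of `ℝ^d` span a hyperplane, the zero set of an affine
function. -/
theorem exists_affineMap_zero_iff {d : ℕ} (hd : 1 ≤ d)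
    (P : Finset (EuclideanSpace ℝ (Fin d))) (hP : P.card = d)
    (hind : AffineIndependent ℝ (fun x : P => (x : EuclideanSpace ℝ (Fin d)))) :
    ∃ f : EuclideanSpace ℝ (Fin d) →ᵃ[ℝ] ℝ,
      ∀ x, f x = 0 ↔ x ∈ affineSpan ℝ (P : Set (EuclideanSpace ℝ (Fin d))) := by
  obtain ⟨p, hp⟩ : P.Nonempty := by
    rw [← Finset.card_pos]
    omega
  set K : Submodule ℝ (EuclideanSpace ℝ (Fin d)) :=
    vectorSpan ℝ (P : Set (EuclideanSpace ℝ (Fin d))) with hK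
  have hfin : Module.finrank ℝ K = d - 1 := by
    have h := hind.finrank_vectorSpan (n := d - 1) (by simp [hP]; omega)
    have hr : Set.range (fun x : P => (x : EuclideanSpace ℝ (Fin d)))
        = (P : Set (EuclideanSpace ℝ (Fin d))) := by
      ext x
      simp
    rw [hr] at h
    exact h
  have hperp : Module.finrank ℝ Kᗮ = 1 := by
    have h := Submodule.finrank_add_finrank_orthogonal K
    rw [hfin, finrank_euclideanSpace_fin] at h
    omega
  obtain ⟨v, -, hv⟩ := finrank_eq_one_iff'.1 hperp
  have hp' : p ∈ affineSpan ℝ (P : Set (EuclideanSpace ℝ (Fin d))) :=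
    subset_affineSpan ℝ _ hp
  refine ⟨(innerₛₗ ℝ (v : EuclideanSpace ℝ (Fin d))).toAffineMap -
    AffineMap.const ℝ _ (inner ℝ (v : EuclideanSpace ℝ (Fin d)) p), fun x => ?_⟩
  have h1 : x ∈ affineSpan ℝ (P : Set (EuclideanSpace ℝ (Fin d))) ↔ x - p ∈ K := by
    rw [← AffineSubspace.vsub_right_mem_direction_iff_mem hp', direction_affineSpan]
    rfl
  have h3 : x - p ∈ K ↔ x - p ∈ Kᗮᗮ := by rw [Submodule.orthogonal_orthogonal K]
  rw [h1, h3, Submodule.mem_orthogonal]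
  have h2 : ((innerₛₗ ℝ (v : EuclideanSpace ℝ (Fin d))).toAffineMap -
      AffineMap.const ℝ (EuclideanSpace ℝ (Fin d))
        (inner ℝ (v : EuclideanSpace ℝ (Fin d)) p)) x
      = inner ℝ (v : EuclideanSpace ℝ (Fin d)) (x - p) := by
    rw [inner_sub_right]
    rfl
  rw [h2]
  constructor
  · intro h u hu
    obtain ⟨c, hc⟩ := hv ⟨u, hu⟩
    have hc' : c • (v : EuclideanSpace ℝ (Fin d)) = u := congrArg Subtype.val hc
    rw [← hc', inner_smul_left, h, mul_zero]
  · intro h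
    exact h v v.2

open Classical in
/-- An affine function whose zero set is the affine hull of `P`. It exists (and its sign is an
arbitrary choice of which side is called left) when `P` consists of `d ≥ 1` affinely independent
points of `ℝ^d`. -/
noncomputable def hyperplaneFunctional {d : ℕ} (P : Finset (EuclideanSpace ℝ (Fin d))) :
    EuclideanSpace ℝ (Fin d) →ᵃ[ℝ] ℝ :=
  if h : ∃ f : EuclideanSpace ℝ (Fin d) →ᵃ[ℝ] ℝ,
      ∀ x, f x = 0 ↔ x ∈ affineSpan ℝ (P : Set (EuclideanSpace ℝ (Fin d)))
  then h.choose else 0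

theorem hyperplaneFunctional_eq_zero_iff {d : ℕ} (hd : 1 ≤ d)
    (P : Finset (EuclideanSpace ℝ (Fin d))) (hP : P.card = d)
    (hind : AffineIndependent ℝ (fun x : P => (x : EuclideanSpace ℝ (Fin d))))
    (x : EuclideanSpace ℝ (Fin d)) :
    hyperplaneFunctional P x = 0 ↔
      x ∈ affineSpan ℝ (P : Set (EuclideanSpace ℝ (Fin d))) := by
  have h := exists_affineMap_zero_iff hd P hP hind
  unfold hyperplaneFunctional
  rw [dif_pos h]
  exact h.choose_spec x

open Classical in
/-- The points of `S` that are not pivots and lie strictly on one side of the hyperplane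
through the pivots `P`. -/
noncomputable def leftPart {d : ℕ} (S P : Finset (EuclideanSpace ℝ (Fin d))) :
    Finset (EuclideanSpace ℝ (Fin d)) :=
  (S \ P).filter (fun x => hyperplaneFunctional P x < 0)

open Classical in
/-- The points of `S` that are not pivots and lie strictly on the other side of the hyperplane
through the pivots `P`. -/
noncomputable def rightPart {d : ℕ} (S P : Finset (EuclideanSpace ℝ (Fin d))) :
    Finset (EuclideanSpace ℝ (Fin d)) :=
  (S \ P).filter (fun x => 0 < hyperplaneFunctional P x)

theorem card_leftPart_lt {d : ℕ} (hd : 1 ≤ d) {S P : Finset (EuclideanSpace ℝ (Fin d))}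
    (hP : P ∈ S.powersetCard d) : (leftPart S P).card < S.card := by
  classical
  obtain ⟨hPS, hPc⟩ := Finset.mem_powersetCard.1 hP
  refine lt_of_le_of_lt (Finset.card_filter_le _ _) ?_
  have h1 := Finset.card_sdiff_add_card_eq_card hPS
  convert (show (S \ P).card < S.card by omega) using 2

theorem card_rightPart_lt {d : ℕ} (hd : 1 ≤ d) {S P : Finset (EuclideanSpace ℝ (Fin d))}
    (hP : P ∈ S.powersetCard d) : (rightPart S P).card < S.card := by
  classical
  obtain ⟨hPS, hPc⟩ := Finset.mem_powersetCard.1 hP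
  refine lt_of_le_of_lt (Finset.card_filter_le _ _) ?_
  have h1 := Finset.card_sdiff_add_card_eq_card hPS
  convert (show (S \ P).card < S.card by omega) using 2

/-- Binary trees whose nodes hold finite sets of data points: a leaf holds its points, an internal
node holds its pivots and has two subtrees. -/
inductive HTree (α : Type) : Type
  | leaf (pts : Finset α) : HTree α
  | node (pivots : Finset α) (left right : HTree α) : HTree α

open Classical in
/-- All data points held by the nodes of a tree. -/
noncomputable def HTree.points {α : Type} : HTree α → Finset α
  | .leaf pts => pts
  | .node pivots left right => pivots ∪ (left.points ∪ right.points)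

open Classical in
/-- The depth of the data point `x`: the number of edges from the root to the node holding `x`. -/
noncomputable def HTree.depth {α : Type} (x : α) : HTree α → ℕ
  | .leaf _ => 0
  | .node pivots left right =>
      if x ∈ pivots then 0
      else if x ∈ left.points then left.depth x + 1
      else right.depth x + 1

/-- The mean depth in the tree `T` of the data points `S`. -/
noncomputable def HTree.meanDepth {α : Type} (S : Finset α) (T : HTree α) : ℝ :=
  (∑ x ∈ S, (T.depth x : ℝ)) / (S.card : ℝ)

open Classical in
/-- The law of the random hyperplane search tree on the point set `S` in `ℝ^d`, `d ≥ 1`. If `S` has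
at least `d` points, a uniformly random `d`-subset is drawn as the set of pivots, and the points on
the two sides of the hyperplane through the pivots are handled recursively and independently.
Otherwise the tree is a single leaf. -/
noncomputable def randomHyperplaneTree {d : ℕ} (S : Finset (EuclideanSpace ℝ (Fin d))) :
    PMF (HTree (EuclideanSpace ℝ (Fin d))) :=
  if h : 1 ≤ d ∧ d ≤ S.card then
    haveI : Nonempty (S.powersetCard d) := (Finset.powersetCard_nonempty.2 h.2).to_subtype
    (PMF.uniformOfFintype (S.powersetCard d)).bind fun P =>
      (randomHyperplaneTree (leftPart S P.1)).bind fun L =>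
        (randomHyperplaneTree (rightPart S P.1)).bind fun R =>
          PMF.pure (HTree.node P.1 L R)
  else PMF.pure (HTree.leaf S)
termination_by S.card
decreasing_by
  · exact card_leftPart_lt h.1 P.2
  · exact card_rightPart_lt h.1 P.2

open Classical in
/-- The law of the depth of a uniformly random data point in the random hyperplane search tree
on `S`: the point is drawn independently of the tree (value `0` by convention if `S` is empty). -/
noncomputable def randomPointDepth {d : ℕ} (S : Finset (EuclideanSpace ℝ (Fin d))) : PMF ℕ :=
  if h : S.Nonempty then
    (randomHyperplaneTree S).bind fun T =>
      (PMF.uniformOfFinset S h).map fun x => T.depth x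
  else PMF.pure 0

/-!
The theorem rests on a bound on how evenly random pivots split a set, and the bound comes from
Radon's theorem. Among `d + 2` points in general position there is one affine dependence `c` up to
scaling. If `f` is an affine function vanishing on all of them except `x` and `y`, then
`c x * f x + c y * f y = 0`, so the hyperplane through the other `d` points separates `x` from `y`
exactly when `c x` and `c y` have the same sign. Whatever the sizes of the two sign classes, a
random pair among the `d + 2` points is therefore separated with probability at least
`d / (2 (d + 1))` (`le_card_separated_pairs`). Averaging over all `(d + 2)`-subsets of an `n`-point
set gives `E (|L| ^ 2 + |R| ^ 2) ≤ q n ^ 2` with `q = (d + 2) / (2 (d + 1))` for the sizes of the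
two parts (`sum_sq_card_parts_le`).

The sum of the squared subset sizes at a given level of the tree thus shrinks by a factor `q` per
level in expectation. In terms of generating functions: if `z q < 1`, then the expectation of
`∑ x ∈ S, z ^ depth x` is at most `A n ^ 2`, where `A` depends on `z` and `d` only
(`expect_weight_le`). Markov's inequality, combined with Jensen's inequality for the mean depth,
bounds both probabilities of exceeding `t` by `A n z ^ (-t)` (`prob_meanDepth_le`,
`prob_randomPointDepth_le`). For `t = (C + ε) log₂ n` with `C = 1 / log₂ (1 / q)` this tends to `0`
once `z` is chosen slightly below `1 / q`. Finally `q = (1 + 1 / (d + 1)) / 2`, so that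
`C = 1 + O (1 / d)`, which is more than the required `1 + O (log d / d)`.
-/

/-! ### Random pivots split a set evenly on average -/

theorem hyperplaneFunctional_of_mem {d : ℕ} (hd : 1 ≤ d)
    {S P : Finset (EuclideanSpace ℝ (Fin d))} (hS : InGeneralPosition S)
    (hP : P ∈ S.powersetCard d) {x : EuclideanSpace ℝ (Fin d)} (hx : x ∈ P) :
    hyperplaneFunctional P x = 0 := by
  obtain ⟨hPS, hPc⟩ := Finset.mem_powersetCard.1 hP
  rw [hyperplaneFunctional_eq_zero_iff hd P hPc (hS P hPS (by omega))]
  exact subset_affineSpan ℝ _ (by simpa using hx)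

/-- In general position, no data point outside the pivots lies on their hyperplane. -/
theorem hyperplaneFunctional_ne_zero {d : ℕ} (hd : 1 ≤ d)
    {S P : Finset (EuclideanSpace ℝ (Fin d))} (hS : InGeneralPosition S)
    (hP : P ∈ S.powersetCard d) {x : EuclideanSpace ℝ (Fin d)} (hx : x ∈ S) (hxP : x ∉ P) :
    hyperplaneFunctional P x ≠ 0 := by
  classical
  obtain ⟨hPS, hPc⟩ := Finset.mem_powersetCard.1 hP
  rw [Ne, hyperplaneFunctional_eq_zero_iff hd P hPc (hS P hPS (by omega))]
  have hind := hS (insert x P) (Finset.insert_subset hx hPS)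
    (by rw [Finset.card_insert_of_notMem hxP, hPc])
  have h := hind.notMem_affineSpan_sdiff ⟨x, Finset.mem_insert_self x P⟩ Set.univ
  convert h using 3
  ext y
  constructor
  · intro hy
    have hy' : y ∈ P := by simpa using hy
    refine ⟨⟨y, Finset.mem_insert_of_mem hy'⟩, ⟨trivial, ?_⟩, rfl⟩
    simp only [Set.mem_singleton_iff, Subtype.mk.injEq]
    rintro rfl
    exact hxP hy'
  · rintro ⟨⟨w, hw⟩, ⟨-, hne⟩, rfl⟩
    simp only [Set.mem_singleton_iff, Subtype.mk.injEq] at hne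
    simpa [hne] using hw

theorem InGeneralPosition.mono {d : ℕ} {S T : Finset (EuclideanSpace ℝ (Fin d))}
    (hS : InGeneralPosition S) (h : T ⊆ S) : InGeneralPosition T :=
  fun U hU => hS U (hU.trans h)

theorem mem_leftPart {d : ℕ} {S P : Finset (EuclideanSpace ℝ (Fin d))}
    {x : EuclideanSpace ℝ (Fin d)} :
    x ∈ leftPart S P ↔ (x ∈ S ∧ x ∉ P) ∧ hyperplaneFunctional P x < 0 := by
  simp [leftPart]

theorem mem_rightPart {d : ℕ} {S P : Finset (EuclideanSpace ℝ (Fin d))}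
    {x : EuclideanSpace ℝ (Fin d)} :
    x ∈ rightPart S P ↔ (x ∈ S ∧ x ∉ P) ∧ 0 < hyperplaneFunctional P x := by
  simp [rightPart]

theorem leftPart_subset {d : ℕ} (S P : Finset (EuclideanSpace ℝ (Fin d))) : leftPart S P ⊆ S :=
  fun _ hx => (mem_leftPart.1 hx).1.1

theorem rightPart_subset {d : ℕ} (S P : Finset (EuclideanSpace ℝ (Fin d))) : rightPart S P ⊆ S :=
  fun _ hx => (mem_rightPart.1 hx).1.1

theorem disjoint_leftPart_rightPart {d : ℕ} (S P : Finset (EuclideanSpace ℝ (Fin d))) :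
    Disjoint (leftPart S P) (rightPart S P) :=
  Finset.disjoint_left.2 fun _ hl hr => lt_asymm (mem_leftPart.1 hl).2 (mem_rightPart.1 hr).2

theorem disjoint_pivots_leftPart_union_rightPart {d : ℕ} [DecidableEq (EuclideanSpace ℝ (Fin d))]
    (S P : Finset (EuclideanSpace ℝ (Fin d))) : Disjoint P (leftPart S P ∪ rightPart S P) := by
  refine Finset.disjoint_left.2 fun x hP h => ?_
  rcases Finset.mem_union.1 h with h | h
  · exact (mem_leftPart.1 h).1.2 hP
  · exact (mem_rightPart.1 h).1.2 hP

theorem pivots_union_parts {d : ℕ} [DecidableEq (EuclideanSpace ℝ (Fin d))] (hd : 1 ≤ d)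
    {S P : Finset (EuclideanSpace ℝ (Fin d))} (hS : InGeneralPosition S)
    (hP : P ∈ S.powersetCard d) : P ∪ (leftPart S P ∪ rightPart S P) = S := by
  ext x
  simp only [Finset.mem_union, mem_leftPart, mem_rightPart]
  constructor
  · rintro (h | h | h)
    · exact (Finset.mem_powersetCard.1 hP).1 h
    · exact h.1.1
    · exact h.1.1
  · intro hx
    by_cases hxP : x ∈ P
    · exact Or.inl hxP
    · rcases lt_or_gt_of_ne (hyperplaneFunctional_ne_zero hd hS hP hx hxP) with h | h
      · exact Or.inr (Or.inl ⟨⟨hx, hxP⟩, h⟩)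
      · exact Or.inr (Or.inr ⟨⟨hx, hxP⟩, h⟩)

theorem card_parts {d : ℕ} (hd : 1 ≤ d)
    {S P : Finset (EuclideanSpace ℝ (Fin d))} (hS : InGeneralPosition S)
    (hP : P ∈ S.powersetCard d) :
    d + ((leftPart S P).card + (rightPart S P).card) = S.card := by
  classical
  have h := congrArg Finset.card (pivots_union_parts hd hS hP)
  rwa [Finset.card_union_of_disjoint (disjoint_pivots_leftPart_union_rightPart S P),
    Finset.card_union_of_disjoint (disjoint_leftPart_rightPart S P),
    (Finset.mem_powersetCard.1 hP).2] at h

/-- For `d + 2` points in general position, the pairs separated by the hyperplane through the other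
`d` points are the pairs whose two members lie in the same class of the Radon partition: if `c` is
the affine dependence of the points and `f` vanishes on all of them but `x` and `y`, then
`c x * f x + c y * f y = 0`. As the two classes have `d + 2` members together, there are at least
`d (d + 2) / 2` ordered pairs of this kind. -/
theorem le_card_separated_pairs {d : ℕ} [DecidableEq (EuclideanSpace ℝ (Fin d))] (hd : 1 ≤ d)
    {Q : Finset (EuclideanSpace ℝ (Fin d))} (hQ : InGeneralPosition Q) (hc : Q.card = d + 2) :
    d * (d + 2) ≤ 2 * (Q.offDiag.filter fun p =>
      hyperplaneFunctional (Q \ {p.1, p.2}) p.1 *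
        hyperplaneFunctional (Q \ {p.1, p.2}) p.2 < 0).card := by
  classical
  obtain ⟨c, hc1, hc0, x₀, hx₀, hcx₀⟩ :=
    Module.exists_nontrivial_relation_sum_zero_of_finrank_succ_lt_card (R := ℝ) (t := Q)
      (by rw [finrank_euclideanSpace_fin]; omega)
  have hpiv : ∀ x ∈ Q, ∀ y ∈ Q, x ≠ y → Q \ {x, y} ∈ Q.powersetCard d := by
    intro x hx y hy hxy
    refine Finset.mem_powersetCard.2 ⟨Finset.sdiff_subset, ?_⟩
    rw [Finset.card_sdiff_of_subset (by simp [Finset.insert_subset_iff, hx, hy]),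
      Finset.card_pair hxy]
    omega
  have hne : ∀ x ∈ Q, ∀ y ∈ Q, x ≠ y → hyperplaneFunctional (Q \ {x, y}) x ≠ 0 ∧
      hyperplaneFunctional (Q \ {x, y}) y ≠ 0 := fun x hx y hy hxy =>
    ⟨hyperplaneFunctional_ne_zero hd hQ (hpiv x hx y hy hxy) hx (by simp),
      hyperplaneFunctional_ne_zero hd hQ (hpiv x hx y hy hxy) hy (by simp)⟩
  have hrel : ∀ x ∈ Q, ∀ y ∈ Q, x ≠ y → c x * hyperplaneFunctional (Q \ {x, y}) x +
      c y * hyperplaneFunctional (Q \ {x, y}) y = 0 := by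
    intro x hx y hy hxy
    set f := hyperplaneFunctional (Q \ {x, y}) with hf
    have hsum : ∑ e ∈ Q, c e * f e = 0 := by
      have h1 : ∀ e, c e * f e = f.linear (c e • e) + c e * f 0 := by
        intro e
        have he : f e = f.linear e + f 0 := congrFun (AffineMap.decomp f) e
        rw [he, map_smul, smul_eq_mul]
        ring
      simp only [h1]
      rw [Finset.sum_add_distrib, ← map_sum, hc1, ← Finset.sum_mul, hc0]
      simp
    rw [← Finset.sum_subset (s₁ := {x, y}) (by simp [Finset.insert_subset_iff, hx, hy])
      (fun e he hne => by
        rw [hf, hyperplaneFunctional_of_mem hd hQ (hpiv x hx y hy hxy)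
          (Finset.mem_sdiff.2 ⟨he, hne⟩), mul_zero]), Finset.sum_pair hxy] at hsum
    exact hsum
  have hcne : ∀ x ∈ Q, c x ≠ 0 := by
    intro x hx h0
    by_cases hxx : x = x₀
    · exact hcx₀ (hxx ▸ h0)
    · have h := hrel x hx x₀ hx₀ hxx
      rw [h0, zero_mul, zero_add] at h
      exact (mul_ne_zero hcx₀ (hne x hx x₀ hx₀ hxx).2) h
  set A := Q.filter fun x => 0 < c x with hA
  set B := Q.filter fun x => c x < 0 with hB
  have hAB : Disjoint A B := Finset.disjoint_left.2 fun x h1 h2 =>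
    lt_asymm (Finset.mem_filter.1 h1).2 (Finset.mem_filter.1 h2).2
  have hABQ : A ∪ B = Q := by
    ext x
    simp only [hA, hB, Finset.mem_union, Finset.mem_filter]
    refine ⟨by rintro (h | h) <;> exact h.1, fun hx => ?_⟩
    rcases lt_or_gt_of_ne (hcne x hx) with h | h
    · exact Or.inr ⟨hx, h⟩
    · exact Or.inl ⟨hx, h⟩
  have hcard : A.card + B.card = d + 2 := by
    rw [← Finset.card_union_of_disjoint hAB, hABQ, hc]
  have hsub : A.offDiag ∪ B.offDiag ⊆ Q.offDiag.filter fun p =>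
      hyperplaneFunctional (Q \ {p.1, p.2}) p.1 *
        hyperplaneFunctional (Q \ {p.1, p.2}) p.2 < 0 := by
    rintro ⟨x, y⟩ h
    have key : ∀ x ∈ Q, ∀ y ∈ Q, x ≠ y → 0 < c x * c y →
        hyperplaneFunctional (Q \ {x, y}) x * hyperplaneFunctional (Q \ {x, y}) y < 0 := by
      intro x hx y hy hxy hpos
      have h := hrel x hx y hy hxy
      have hy0 := (hne x hx y hy hxy).2
      set u := hyperplaneFunctional (Q \ {x, y}) x
      set v := hyperplaneFunctional (Q \ {x, y}) y
      have h2 : (c x * c y) * (u * v) = - (c y * v) ^ 2 := by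
        linear_combination (c y * v) * h
      have h3 : 0 < (c y * v) ^ 2 := by
        have := mul_ne_zero (hcne y hy) hy0
        positivity
      by_contra hcon
      have := mul_nonneg hpos.le (not_lt.1 hcon)
      linarith
    rcases Finset.mem_union.1 h with h | h
    · simp only [Finset.mem_offDiag, hA, Finset.mem_filter] at h ⊢
      exact ⟨⟨h.1.1, h.2.1.1, h.2.2⟩,
        key x h.1.1 y h.2.1.1 h.2.2 (mul_pos h.1.2 h.2.1.2)⟩
    · simp only [Finset.mem_offDiag, hB, Finset.mem_filter] at h ⊢
      exact ⟨⟨h.1.1, h.2.1.1, h.2.2⟩,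
        key x h.1.1 y h.2.1.1 h.2.2 (mul_pos_of_neg_of_neg h.1.2 h.2.1.2)⟩
  have hdisj : Disjoint A.offDiag B.offDiag := Finset.disjoint_left.2 fun p h1 h2 =>
    Finset.disjoint_left.1 hAB (Finset.mem_offDiag.1 h1).1 (Finset.mem_offDiag.1 h2).1
  have hle := Finset.card_le_card hsub
  rw [Finset.card_union_of_disjoint hdisj, Finset.offDiag_card, Finset.offDiag_card] at hle
  refine le_trans ?_ (Nat.mul_le_mul_left 2 hle)
  have ha := Nat.le_mul_self A.card
  have hb := Nat.le_mul_self B.card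
  zify [ha, hb]
  zify at hcard
  have hd' : (d : ℤ) = A.card + B.card - 2 := by linarith
  rw [hd']
  nlinarith [sq_nonneg ((A.card : ℤ) - B.card)]

/-- Each `(d + 2)`-subset with a separated pair in it gives a set of pivots (the remaining `d`
points) and two points on opposite sides of their hyperplane; `2 |L| |R|` counts the latter. -/
theorem le_sum_card_leftPart_mul_card_rightPart {d : ℕ} (hd : 1 ≤ d)
    {S : Finset (EuclideanSpace ℝ (Fin d))} (hS : InGeneralPosition S) :
    S.card.choose (d + 2) * (d * (d + 2)) ≤
      4 * ∑ P ∈ S.powersetCard d, (leftPart S P).card * (rightPart S P).card := by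
  classical
  let sep : Finset (EuclideanSpace ℝ (Fin d)) →
      Finset (EuclideanSpace ℝ (Fin d) × EuclideanSpace ℝ (Fin d)) := fun Q =>
    Q.offDiag.filter fun p => hyperplaneFunctional (Q \ {p.1, p.2}) p.1 *
        hyperplaneFunctional (Q \ {p.1, p.2}) p.2 < 0
  let opp : Finset (EuclideanSpace ℝ (Fin d)) →
      Finset (EuclideanSpace ℝ (Fin d) × EuclideanSpace ℝ (Fin d)) := fun P =>
    leftPart S P ×ˢ rightPart S P ∪ rightPart S P ×ˢ leftPart S P
  have hinj : ((S.powersetCard (d + 2)).sigma sep).card ≤ ((S.powersetCard d).sigma opp).card := by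
    have hmem : ∀ s ∈ (S.powersetCard (d + 2)).sigma sep,
        s.1 ⊆ S ∧ s.1.card = d + 2 ∧ s.2.1 ∈ s.1 ∧ s.2.2 ∈ s.1 ∧ s.2.1 ≠ s.2.2 ∧
        hyperplaneFunctional (s.1 \ {s.2.1, s.2.2}) s.2.1 *
        hyperplaneFunctional (s.1 \ {s.2.1, s.2.2}) s.2.2 < 0 := by
      rintro ⟨Q, x, y⟩ h
      simp only [sep, Finset.mem_sigma, Finset.mem_powersetCard, Finset.mem_filter,
        Finset.mem_offDiag] at h
      exact ⟨h.1.1, h.1.2, h.2.1.1, h.2.1.2.1, h.2.1.2.2, h.2.2⟩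
    refine Finset.card_le_card_of_injOn (fun s => ⟨s.1 \ {s.2.1, s.2.2}, s.2⟩) ?_ ?_
    · rintro ⟨Q, x, y⟩ h
      obtain ⟨hQS, hQc, hx, hy, hxy, hneg⟩ := hmem _ h
      simp only at hQS hQc hx hy hxy hneg
      have hc : (Q \ {x, y}).card = d := by
        rw [Finset.card_sdiff_of_subset (by simp [Finset.insert_subset_iff, hx, hy]),
          Finset.card_pair hxy]
        omega
      simp only [opp, Finset.coe_sigma, Set.mem_sigma_iff, Finset.mem_coe,
        Finset.mem_powersetCard, Finset.mem_union, Finset.mem_product, mem_leftPart,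
        mem_rightPart]
      refine ⟨⟨Finset.sdiff_subset.trans hQS, hc⟩, ?_⟩
      rcases mul_neg_iff.1 hneg with ⟨h1, h2⟩ | ⟨h1, h2⟩
      · exact Or.inr ⟨⟨⟨hQS hx, by simp⟩, h1⟩, ⟨⟨hQS hy, by simp⟩, h2⟩⟩
      · exact Or.inl ⟨⟨⟨hQS hx, by simp⟩, h1⟩, ⟨⟨hQS hy, by simp⟩, h2⟩⟩
    · rintro ⟨Q, x, y⟩ h ⟨Q', x', y'⟩ h' heq
      obtain ⟨-, -, hx, hy, -⟩ := hmem _ h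
      obtain ⟨-, -, hx', hy', -⟩ := hmem _ h'
      simp only at hx hy hx' hy'
      simp only [Sigma.mk.injEq, heq_eq_eq, Prod.mk.injEq] at heq
      obtain ⟨hQ, rfl, rfl⟩ := heq
      have e : Q = Q' := by
        rw [← Finset.sdiff_union_of_subset (s₁ := {x, y}) (s₂ := Q)
            (by simp [Finset.insert_subset_iff, hx, hy]), hQ,
          Finset.sdiff_union_of_subset (by simp [Finset.insert_subset_iff, hx', hy'])]
      rw [e]
  rw [Finset.card_sigma, Finset.card_sigma] at hinj
  have h1 : S.card.choose (d + 2) * (d * (d + 2)) ≤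
      2 * ∑ Q ∈ S.powersetCard (d + 2), (sep Q).card := by
    rw [← Finset.card_powersetCard, ← smul_eq_mul, ← Finset.sum_const, Finset.mul_sum]
    refine Finset.sum_le_sum fun Q hQ => ?_
    obtain ⟨hQS, hQc⟩ := Finset.mem_powersetCard.1 hQ
    exact le_card_separated_pairs hd (hS.mono hQS) hQc
  have h2 : ∑ P ∈ S.powersetCard d, (opp P).card ≤
      2 * ∑ P ∈ S.powersetCard d, (leftPart S P).card * (rightPart S P).card := by
    rw [Finset.mul_sum]
    refine Finset.sum_le_sum fun P _ => ?_
    refine (Finset.card_union_le _ _).trans ?_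
    rw [Finset.card_product, Finset.card_product]
    exact le_of_eq (by ring)
  omega

/-- The expected sum of the squared sizes of the two parts, relative to the squared size of the
whole set, is at most this ratio. It is `1 / 2`, the value of an even split, up to `O (1 / d)`. -/
noncomputable def splitRatio (d : ℕ) : ℝ := (d + 2) / (2 * (d + 1))

theorem splitRatio_pos (d : ℕ) : 0 < splitRatio d := by
  unfold splitRatio
  positivity

/-- The square of the part sizes, averaged over the pivots, shrinks by the factor
`splitRatio d`. -/
theorem sum_sq_card_parts_le {d : ℕ} (hd : 1 ≤ d)
    {S : Finset (EuclideanSpace ℝ (Fin d))} (hS : InGeneralPosition S) (hn : d ≤ S.card) :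
    ∑ P ∈ S.powersetCard d, (((leftPart S P).card : ℝ) ^ 2 + ((rightPart S P).card : ℝ) ^ 2) ≤
      splitRatio d * (S.card : ℝ) ^ 2 * (S.card.choose d : ℝ) := by
  obtain ⟨N, hN⟩ := Nat.exists_eq_add_of_le hn
  have hsep := le_sum_card_leftPart_mul_card_rightPart hd hS
  set W := ∑ P ∈ S.powersetCard d, (leftPart S P).card * (rightPart S P).card with hW
  have hchoose : S.card.choose (d + 2) * ((d + 2) * (d + 1)) = S.card.choose d * (N * (N - 1)) := by
    have h1 := Nat.choose_succ_right_eq S.card d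
    have h2 := Nat.choose_succ_right_eq S.card (d + 1)
    have e1 : S.card - d = N := by omega
    have e2 : S.card - (d + 1) = N - 1 := by omega
    rw [e1] at h1
    rw [e2] at h2
    calc _ = (S.card.choose (d + 1 + 1) * (d + 1 + 1)) * (d + 1) := by ring
      _ = (S.card.choose (d + 1) * (d + 1)) * (N - 1) := by rw [h2]; ring
      _ = _ := by rw [h1]; ring
  have hchooseR : (S.card.choose (d + 2) : ℝ) * ((d + 2) * (d + 1)) =
      S.card.choose d * (N * (N - 1)) := by
    rcases Nat.eq_zero_or_pos N with h0 | h0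
    · have := hchoose
      rw [h0] at this ⊢
      simp only [zero_mul, mul_zero] at this
      have h3 : ((S.card.choose (d + 2) * ((d + 2) * (d + 1)) : ℕ) : ℝ) = 0 := by
        rw [this]; simp
      push_cast at h3
      rw [h3]; simp
    · have := congrArg (Nat.cast (R := ℝ)) hchoose
      push_cast [Nat.cast_sub h0] at this
      exact this
  have hsepR : (S.card.choose (d + 2) : ℝ) * (d * (d + 2)) ≤ 4 * (W : ℝ) := by
    exact_mod_cast hsep
  have hLR : ∑ P ∈ S.powersetCard d,
      (((leftPart S P).card : ℝ) ^ 2 + ((rightPart S P).card : ℝ) ^ 2) =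
      (S.card.choose d : ℝ) * (N : ℝ) ^ 2 - 2 * (W : ℝ) := by
    have h : ∀ P ∈ S.powersetCard d,
        ((leftPart S P).card : ℝ) ^ 2 + ((rightPart S P).card : ℝ) ^ 2 =
        (N : ℝ) ^ 2 - 2 * (((leftPart S P).card : ℝ) * ((rightPart S P).card : ℝ)) := by
      intro P hP
      have h1 := card_parts hd hS hP
      have h2 : (leftPart S P).card + (rightPart S P).card = N := by omega
      have h3 : (N : ℝ) = (leftPart S P).card + (rightPart S P).card := by
        rw [← h2]; push_cast; rfl
      rw [h3]
      ring
    rw [Finset.sum_congr rfl h, Finset.sum_sub_distrib, Finset.sum_const,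
      Finset.card_powersetCard, nsmul_eq_mul, ← Finset.mul_sum, hW]
    push_cast
    rfl
  rw [hLR, hN]
  push_cast
  rw [hN] at hchooseR hsepR
  set K : ℝ := ((d + N).choose d : ℝ)
  have hK : 0 ≤ K := Nat.cast_nonneg _
  have hd1 : (1 : ℝ) ≤ d := by exact_mod_cast hd
  have hNn : (0 : ℝ) ≤ N := Nat.cast_nonneg _
  have hlow : K * (N * (N - 1)) * (d / (2 * (d + 1))) ≤ 2 * (W : ℝ) := by
    have : K * (N * (N - 1)) * (d / (2 * (d + 1))) =
        ((d + N).choose (d + 2) : ℝ) * (d * (d + 2)) / 2 := by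
      rw [← hchooseR]
      field_simp
    rw [this]
    linarith
  have hpoly : (N : ℝ) ^ 2 - N * (N - 1) * (d / (2 * (d + 1))) ≤ splitRatio d * (d + N) ^ 2 := by
    have hexp : splitRatio d * (d + N : ℝ) ^ 2 -
        ((N : ℝ) ^ 2 - N * (N - 1) * (d / (2 * (d + 1)))) =
        ((d + 2) * d ^ 2 + N * (2 * d ^ 2 + 3 * d)) / (2 * (d + 1)) := by
      unfold splitRatio
      field_simp
      ring
    have : 0 ≤ ((d + 2) * d ^ 2 + N * (2 * d ^ 2 + 3 * d)) / (2 * ((d : ℝ) + 1)) := by positivity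
    linarith
  have := mul_le_mul_of_nonneg_left hpoly hK
  nlinarith

/-! ### Expectations of nonnegative functions under a `PMF` -/

namespace PMF

open scoped ENNReal

variable {α β : Type*}

/-- The expectation of a nonnegative function `f` under `p`. Being a sum, it needs no measurable
structure on `α`. -/
noncomputable def expect (p : PMF α) (f : α → ℝ≥0∞) : ℝ≥0∞ := ∑' a, p a * f a

theorem expect_pure (a : α) (f : α → ℝ≥0∞) : (PMF.pure a).expect f = f a := by
  classical
  unfold expect
  rw [tsum_eq_single a]
  · simp
  · intro b hb
    simp [hb]

theorem expect_bind (p : PMF α) (g : α → PMF β) (f : β → ℝ≥0∞) :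
    (p.bind g).expect f = p.expect fun a => (g a).expect f := by
  unfold expect
  simp only [bind_apply, ← ENNReal.tsum_mul_right, ← ENNReal.tsum_mul_left]
  rw [ENNReal.tsum_comm]
  simp only [mul_assoc]

theorem expect_map (p : PMF α) (g : α → β) (f : β → ℝ≥0∞) :
    (p.map g).expect f = p.expect fun a => f (g a) := by
  simp only [PMF.map, expect_bind, Function.comp_apply, expect_pure]

theorem expect_mono {p : PMF α} {f g : α → ℝ≥0∞} (h : ∀ a ∈ p.support, f a ≤ g a) :
    p.expect f ≤ p.expect g := by
  refine ENNReal.tsum_le_tsum fun a => ?_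
  by_cases ha : a ∈ p.support
  · gcongr
    exact h a ha
  · rw [(p.apply_eq_zero_iff a).2 ha]
    simp

theorem expect_add (p : PMF α) (f g : α → ℝ≥0∞) :
    (p.expect fun a => f a + g a) = p.expect f + p.expect g := by
  simp only [expect, mul_add, ENNReal.tsum_add]

theorem expect_const_mul (p : PMF α) (c : ℝ≥0∞) (f : α → ℝ≥0∞) :
    (p.expect fun a => c * f a) = c * p.expect f := by
  simp only [expect, ← ENNReal.tsum_mul_left]
  exact tsum_congr fun a => by ring

theorem expect_const (p : PMF α) (c : ℝ≥0∞) : (p.expect fun _ => c) = c := by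
  simp only [expect, ENNReal.tsum_mul_right, tsum_coe, one_mul]

theorem expect_uniformOfFintype [Fintype α] [Nonempty α] (f : α → ℝ≥0∞) :
    (uniformOfFintype α).expect f = (Fintype.card α : ℝ≥0∞)⁻¹ * ∑ a, f a := by
  simp only [expect, uniformOfFintype_apply, tsum_fintype, Finset.mul_sum]

theorem expect_uniformOfFinset (s : Finset α) (hs : s.Nonempty) (f : α → ℝ≥0∞) :
    (uniformOfFinset s hs).expect f = (s.card : ℝ≥0∞)⁻¹ * ∑ a ∈ s, f a := by
  unfold expect
  rw [tsum_eq_sum (s := s) (fun a ha => by rw [uniformOfFinset_apply_of_notMem hs ha, zero_mul]),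
    Finset.mul_sum]
  exact Finset.sum_congr rfl fun a ha => by rw [uniformOfFinset_apply_of_mem hs ha]

/-- Markov's inequality. -/
theorem toOuterMeasure_mul_le_expect (p : PMF α) {f : α → ℝ≥0∞} {s : Set α} {c : ℝ≥0∞}
    (h : ∀ a ∈ s, c ≤ f a) : p.toOuterMeasure s * c ≤ p.expect f := by
  rw [toOuterMeasure_apply, ← ENNReal.tsum_mul_right]
  refine ENNReal.tsum_le_tsum fun a => ?_
  by_cases ha : a ∈ s
  · rw [Set.indicator_of_mem ha]
    gcongr
    exact h a ha
  · rw [Set.indicator_of_notMem ha, zero_mul]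
    exact zero_le

end PMF

/-! ### The exponential moment of the depth -/

theorem randomHyperplaneTree_of_lt {d : ℕ} {S : Finset (EuclideanSpace ℝ (Fin d))}
    (h : S.card < d) : randomHyperplaneTree S = PMF.pure (HTree.leaf S) := by
  rw [randomHyperplaneTree, dif_neg (by omega)]

open Classical in
theorem randomHyperplaneTree_of_le {d : ℕ} {S : Finset (EuclideanSpace ℝ (Fin d))}
    (hd : 1 ≤ d) (h : d ≤ S.card) [Nonempty (S.powersetCard d)] :
    randomHyperplaneTree S =
      (PMF.uniformOfFintype (S.powersetCard d)).bind fun P =>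
        (randomHyperplaneTree (leftPart S P.1)).bind fun L =>
          (randomHyperplaneTree (rightPart S P.1)).bind fun R =>
            PMF.pure (HTree.node P.1 L R) := by
  rw [randomHyperplaneTree, dif_pos ⟨hd, h⟩]

/-- In general position the tree holds exactly the given points. -/
theorem points_eq_of_mem_support {d : ℕ} (hd : 1 ≤ d) (S : Finset (EuclideanSpace ℝ (Fin d)))
    (hS : InGeneralPosition S) (T : HTree (EuclideanSpace ℝ (Fin d)))
    (hT : T ∈ (randomHyperplaneTree S).support) : T.points = S := by
  classical
  induction hn : S.card using Nat.strong_induction_on generalizing S T with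
  | _ n ih =>
    subst hn
    rcases lt_or_ge S.card d with h | h
    · rw [randomHyperplaneTree_of_lt h] at hT
      have : T = HTree.leaf S := by simpa using hT
      rw [this, HTree.points]
    · have : Nonempty (S.powersetCard d) := (Finset.powersetCard_nonempty.2 h).to_subtype
      rw [randomHyperplaneTree_of_le hd h] at hT
      simp only [PMF.mem_support_bind_iff, PMF.support_pure, Set.mem_singleton_iff] at hT
      obtain ⟨⟨P, hP⟩, -, L, hL, R, hR, rfl⟩ := hT
      rw [HTree.points, ih _ (card_leftPart_lt hd hP) _ (hS.mono (leftPart_subset S P)) L hL rfl,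
        ih _ (card_rightPart_lt hd hP) _ (hS.mono (rightPart_subset S P)) R hR rfl]
      convert pivots_union_parts hd hS hP

/-- The sum of the exponential weights `z ^ depth` over the points of `S`. -/
noncomputable def HTree.weight {α : Type} (z : ℝ) (S : Finset α) (T : HTree α) : ENNReal :=
  ∑ x ∈ S, ENNReal.ofReal (z ^ T.depth x)

theorem HTree.weight_node {d : ℕ} (hd : 1 ≤ d) {z : ℝ} (hz : 0 ≤ z)
    {S P : Finset (EuclideanSpace ℝ (Fin d))}
    (hS : InGeneralPosition S) (hP : P ∈ S.powersetCard d)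
    {L R : HTree (EuclideanSpace ℝ (Fin d))} (hL : L.points = leftPart S P) :
    (HTree.node P L R).weight z S =
      d + ENNReal.ofReal z * (L.weight z (leftPart S P) + R.weight z (rightPart S P)) := by
  classical
  unfold HTree.weight
  conv_lhs => rw [← pivots_union_parts hd hS hP]
  rw [Finset.sum_union (disjoint_pivots_leftPart_union_rightPart S P),
    Finset.sum_union (disjoint_leftPart_rightPart S P), mul_add, Finset.mul_sum, Finset.mul_sum]
  congr 1
  · have h : ∀ x ∈ P, ENNReal.ofReal (z ^ (HTree.node P L R).depth x) = 1 := by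
      intro x hx
      simp [HTree.depth, hx]
    rw [Finset.sum_congr rfl h]
    simp [(Finset.mem_powersetCard.1 hP).2]
  congr 1
  · refine Finset.sum_congr rfl fun x hx => ?_
    have hxP := (mem_leftPart.1 hx).1.2
    rw [HTree.depth, if_neg hxP, hL, if_pos hx, pow_succ', ENNReal.ofReal_mul hz]
  · refine Finset.sum_congr rfl fun x hx => ?_
    have hxP := (mem_rightPart.1 hx).1.2
    have hxL := Finset.disjoint_right.1 (disjoint_leftPart_rightPart S P) hx
    rw [HTree.depth, if_neg hxP, hL, if_neg hxL, pow_succ', ENNReal.ofReal_mul hz]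

/-- As long as `z` times the split ratio is below `1`, the bound `A n ^ 2` reproduces itself through
the recursion: `d + z * splitRatio d * A n ^ 2 ≤ A n ^ 2`. -/
theorem expect_weight_le {d : ℕ} (hd : 1 ≤ d) {z : ℝ} (hz : 0 ≤ z)
    (hzq : z * splitRatio d < 1) (S : Finset (EuclideanSpace ℝ (Fin d)))
    (hS : InGeneralPosition S) :
    (randomHyperplaneTree S).expect (HTree.weight z S) ≤
      ENNReal.ofReal (d / (1 - z * splitRatio d) * (S.card : ℝ) ^ 2) := by
  classical
  have hd1 : (1 : ℝ) ≤ d := by exact_mod_cast hd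
  have hq := splitRatio_pos d
  have hzq0 : 0 ≤ z * splitRatio d := mul_nonneg hz hq.le
  set A : ℝ := d / (1 - z * splitRatio d) with hA
  have hAeq : A * (1 - z * splitRatio d) = d := div_mul_cancel₀ _ (by linarith)
  have hA1 : 1 ≤ A := by
    rw [hA, one_le_div (by linarith)]
    linarith
  induction hn : S.card using Nat.strong_induction_on generalizing S with
  | _ n ih =>
    subst hn
    rcases lt_or_ge S.card d with h | h
    · rw [randomHyperplaneTree_of_lt h, PMF.expect_pure]
      have : (HTree.leaf S).weight z S = ENNReal.ofReal (S.card : ℝ) := by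
        simp [HTree.weight, HTree.depth]
      rw [this]
      refine ENNReal.ofReal_le_ofReal ?_
      have h2 : (S.card : ℝ) ≤ (S.card : ℝ) ^ 2 := by
        exact_mod_cast Nat.le_self_pow two_ne_zero S.card
      nlinarith [sq_nonneg (S.card : ℝ)]
    · have : Nonempty (S.powersetCard d) := (Finset.powersetCard_nonempty.2 h).to_subtype
      rw [randomHyperplaneTree_of_le hd h]
      simp only [PMF.expect_bind, PMF.expect_pure]
      have hinner : ∀ P : S.powersetCard d,
          ((randomHyperplaneTree (leftPart S P.1)).expect fun L =>
            (randomHyperplaneTree (rightPart S P.1)).expect fun R =>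
              (HTree.node P.1 L R).weight z S) ≤
          ENNReal.ofReal (d + z * (A * ((leftPart S P.1).card : ℝ) ^ 2 +
            A * ((rightPart S P.1).card : ℝ) ^ 2)) := by
        rintro ⟨P, hP⟩
        have hSL := hS.mono (leftPart_subset S P)
        have hSR := hS.mono (rightPart_subset S P)
        calc _ ≤ (randomHyperplaneTree (leftPart S P)).expect fun L =>
              (randomHyperplaneTree (rightPart S P)).expect fun R =>
                d + ENNReal.ofReal z *
                  (L.weight z (leftPart S P) + R.weight z (rightPart S P)) := by
              refine PMF.expect_mono fun L hL => PMF.expect_mono fun R _ => ?_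
              exact (HTree.weight_node hd hz hS hP
                (points_eq_of_mem_support hd _ hSL L hL)).le
          _ = d + ENNReal.ofReal z *
                ((randomHyperplaneTree (leftPart S P)).expect (HTree.weight z (leftPart S P)) +
                (randomHyperplaneTree (rightPart S P)).expect
                  (HTree.weight z (rightPart S P))) := by
              simp only [PMF.expect_add, PMF.expect_const_mul, PMF.expect_const]
          _ ≤ d + ENNReal.ofReal z *
                (ENNReal.ofReal (A * ((leftPart S P).card : ℝ) ^ 2) +
                ENNReal.ofReal (A * ((rightPart S P).card : ℝ) ^ 2)) := by
              gcongr
              · exact ih _ (card_leftPart_lt hd hP) _ hSL rfl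
              · exact ih _ (card_rightPart_lt hd hP) _ hSR rfl
          _ = _ := by
              rw [← ENNReal.ofReal_add (by positivity) (by positivity), ← ENNReal.ofReal_mul hz,
                ENNReal.ofReal_add (by positivity) (by positivity), ENNReal.ofReal_natCast]
      refine (PMF.expect_mono fun P _ => hinner P).trans ?_
      have hK : 0 < ((S.card.choose d : ℕ) : ℝ) := by exact_mod_cast Nat.choose_pos h
      rw [PMF.expect_uniformOfFintype, Fintype.card_coe, Finset.card_powersetCard,
        Finset.sum_coe_sort (S.powersetCard d) fun P => ENNReal.ofReal
          (d + z * (A * ((leftPart S P).card : ℝ) ^ 2 + A * ((rightPart S P).card : ℝ) ^ 2)),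
        ← ENNReal.ofReal_sum_of_nonneg (fun P _ => by positivity),
        ← ENNReal.ofReal_natCast, ← ENNReal.ofReal_inv_of_pos hK,
        ← ENNReal.ofReal_mul (by positivity)]
      refine ENNReal.ofReal_le_ofReal ?_
      rw [inv_mul_le_iff₀ hK]
      have hsum : ∑ P ∈ S.powersetCard d, (d + z * (A * ((leftPart S P).card : ℝ) ^ 2 +
          A * ((rightPart S P).card : ℝ) ^ 2)) = (S.card.choose d : ℝ) * d + z * A *
          ∑ P ∈ S.powersetCard d,
            (((leftPart S P).card : ℝ) ^ 2 + ((rightPart S P).card : ℝ) ^ 2) := by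
        rw [Finset.sum_add_distrib, Finset.sum_const, Finset.card_powersetCard, nsmul_eq_mul,
          Finset.mul_sum]
        congr 1
        exact Finset.sum_congr rfl fun P _ => by ring
      rw [hsum]
      have hsq := mul_le_mul_of_nonneg_left (sum_sq_card_parts_le hd hS h)
        (mul_nonneg hz (zero_le_one.trans hA1))
      have hn1 : (1 : ℝ) ≤ (S.card : ℝ) ^ 2 := by
        have : (1 : ℝ) ≤ S.card := by exact_mod_cast hd.trans h
        nlinarith
      have hdn : (d : ℝ) ≤ A * (1 - z * splitRatio d) * (S.card : ℝ) ^ 2 := by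
        rw [hAeq]
        nlinarith
      have := mul_le_mul_of_nonneg_left hdn hK.le
      linarith

/-! ### Tail bounds -/

/-- By Jensen's inequality, a large mean depth forces a large exponential weight. -/
theorem le_weight_of_le_meanDepth {α : Type} {S : Finset α} (hS : S.Nonempty) {s t : ℝ}
    (hs : 0 ≤ s) {T : HTree α} (h : t ≤ T.meanDepth S) :
    ENNReal.ofReal (S.card * Real.exp (s * t)) ≤ T.weight (Real.exp s) S := by
  have hc : (0 : ℝ) < S.card := by exact_mod_cast hS.card_pos
  unfold HTree.weight
  rw [← ENNReal.ofReal_sum_of_nonneg (fun x _ => by positivity)]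
  refine ENNReal.ofReal_le_ofReal ?_
  have hj := convexOn_exp.map_sum_le (t := S) (w := fun _ => (S.card : ℝ)⁻¹)
    (p := fun x => s * T.depth x) (fun _ _ => by positivity)
    (by rw [Finset.sum_const, nsmul_eq_mul, mul_inv_cancel₀ hc.ne']) (fun _ _ => trivial)
  simp only [smul_eq_mul, ← Finset.mul_sum] at hj
  rw [le_inv_mul_iff₀ hc] at hj
  have he : ∑ x ∈ S, Real.exp (s * T.depth x) = ∑ x ∈ S, Real.exp s ^ T.depth x :=
    Finset.sum_congr rfl fun x _ => by rw [mul_comm, Real.exp_nat_mul]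
  rw [he] at hj
  refine le_trans (mul_le_mul_of_nonneg_left (Real.exp_le_exp.2 ?_) hc.le) hj
  calc s * t ≤ s * T.meanDepth S := by gcongr
    _ = _ := by unfold HTree.meanDepth; ring

theorem prob_meanDepth_le {d : ℕ} (hd : 1 ≤ d) {s : ℝ} (hs : 0 ≤ s)
    (hsq : Real.exp s * splitRatio d < 1) {S : Finset (EuclideanSpace ℝ (Fin d))}
    (hne : S.Nonempty) (hS : InGeneralPosition S) (t : ℝ) :
    (randomHyperplaneTree S).toOuterMeasure {T | t ≤ T.meanDepth S} ≤
      ENNReal.ofReal (d / (1 - Real.exp s * splitRatio d) * (S.card * Real.exp (-(s * t)))) := by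
  have hc : (0 : ℝ) < S.card := by exact_mod_cast hne.card_pos
  have hpos : 0 < S.card * Real.exp (s * t) := by positivity
  have h := (PMF.toOuterMeasure_mul_le_expect (randomHyperplaneTree S)
    (s := {T | t ≤ T.meanDepth S})
    (fun T hT => le_weight_of_le_meanDepth hne hs hT)).trans
    (expect_weight_le hd (Real.exp_pos s).le hsq S hS)
  rw [← ENNReal.le_div_iff_mul_le (Or.inl (ENNReal.ofReal_pos.2 hpos).ne')
      (Or.inl ENNReal.ofReal_ne_top),
    ← ENNReal.ofReal_div_of_pos hpos] at h
  convert h using 2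
  rw [Real.exp_neg]
  field_simp

theorem prob_randomPointDepth_le {d : ℕ} (hd : 1 ≤ d) {s : ℝ} (hs : 0 ≤ s)
    (hsq : Real.exp s * splitRatio d < 1) {S : Finset (EuclideanSpace ℝ (Fin d))}
    (hne : S.Nonempty) (hS : InGeneralPosition S) (t : ℝ) :
    (randomPointDepth S).toOuterMeasure {k | t ≤ (k : ℝ)} ≤
      ENNReal.ofReal (d / (1 - Real.exp s * splitRatio d) * (S.card * Real.exp (-(s * t)))) := by
  have hc : (0 : ℝ) < S.card := by exact_mod_cast hne.card_pos
  have hmarkov := PMF.toOuterMeasure_mul_le_expect (randomPointDepth S)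
    (s := {k | t ≤ (k : ℝ)}) (f := fun k => ENNReal.ofReal (Real.exp s ^ k))
    (c := ENNReal.ofReal (Real.exp (s * t))) (fun k hk => by
      refine ENNReal.ofReal_le_ofReal ?_
      rw [← Real.exp_nat_mul, mul_comm (k : ℝ)]
      have : t ≤ (k : ℝ) := hk
      gcongr)
  have hexp : (randomPointDepth S).expect (fun k => ENNReal.ofReal (Real.exp s ^ k)) =
      (S.card : ENNReal)⁻¹ *
        (randomHyperplaneTree S).expect (HTree.weight (Real.exp s) S) := by
    rw [randomPointDepth, dif_pos hne, PMF.expect_bind]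
    simp only [PMF.expect_map, PMF.expect_uniformOfFinset, PMF.expect_const_mul]
    rfl
  rw [hexp] at hmarkov
  have h := hmarkov.trans (mul_le_mul_right
    (expect_weight_le hd (Real.exp_pos s).le hsq S hS) (S.card : ENNReal)⁻¹)
  rw [← ENNReal.ofReal_natCast, ← ENNReal.ofReal_inv_of_pos hc,
    ← ENNReal.ofReal_mul (by positivity),
    ← ENNReal.le_div_iff_mul_le (Or.inl (ENNReal.ofReal_pos.2 (Real.exp_pos _)).ne')
      (Or.inl ENNReal.ofReal_ne_top),
    ← ENNReal.ofReal_div_of_pos (Real.exp_pos _)] at h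
  convert h using 2
  rw [Real.exp_neg]
  field_simp

/-! ### The constant -/

/-- The constant `C(d)`: sizes shrink so that `n ^ 2 * splitRatio d ^ k` is of order `n` at depth
`k = C(d) * log₂ n`. -/
noncomputable def depthConstant (d : ℕ) : ℝ := (Real.logb 2 (splitRatio d)⁻¹)⁻¹

theorem logb_inv_splitRatio (d : ℕ) :
    Real.logb 2 (splitRatio d)⁻¹ = 1 - Real.logb 2 (1 + 1 / ((d : ℝ) + 1)) := by
  have h : (splitRatio d)⁻¹ = 2 / (1 + 1 / ((d : ℝ) + 1)) := by
    unfold splitRatio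
    field_simp
    ring
  rw [h, Real.logb_div (by norm_num) (by positivity), Real.logb_self_eq_one (by norm_num)]

theorem depthConstant_pos {d : ℕ} (hd : 1 ≤ d) : 0 < depthConstant d := by
  unfold depthConstant
  refine inv_pos.2 (Real.logb_pos (by norm_num) ?_)
  have hd1 : (1 : ℝ) ≤ d := by exact_mod_cast hd
  rw [one_lt_inv₀ (splitRatio_pos d), splitRatio, div_lt_one (by positivity)]
  linarith

theorem depthConstant_sub_one_isBigO :
    (fun d : ℕ => depthConstant d - 1) =O[atTop]
      (fun d : ℕ => Real.log (d : ℝ) / (d : ℝ)) := by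
  refine IsBigO.of_bound (2 / Real.log 2) ?_
  filter_upwards [eventually_ge_atTop 3] with d hd
  have hd3 : (3 : ℝ) ≤ d := by exact_mod_cast hd
  have hl2 : 0 < Real.log 2 := Real.log_pos (by norm_num)
  have hl2' : 1 / 2 < Real.log 2 := by linarith [Real.log_two_gt_d9]
  set v := Real.logb 2 (1 + 1 / ((d : ℝ) + 1)) with hv
  have hv0 : 0 ≤ v := Real.logb_nonneg (by norm_num) (by
    have : 0 < 1 / ((d : ℝ) + 1) := by positivity
    linarith)
  have hv1 : v ≤ 1 / (d * Real.log 2) := by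
    rw [hv, Real.logb, div_le_iff₀ hl2]
    have h1 := Real.log_le_sub_one_of_pos (x := 1 + 1 / ((d : ℝ) + 1)) (by positivity)
    have h2 : 1 / ((d : ℝ) + 1) ≤ 1 / d := by gcongr; linarith
    have h3 : 1 / (d * Real.log 2) * Real.log 2 = 1 / d := by field_simp
    linarith
  have hvhalf : v ≤ 1 / 2 := by
    rw [hv, Real.logb_le_iff_le_rpow (by norm_num) (by positivity), ← Real.sqrt_eq_rpow]
    refine Real.le_sqrt_of_sq_le ?_
    have h2 : 1 / ((d : ℝ) + 1) ≤ 1 / 4 := by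
      apply one_div_le_one_div_of_le <;> linarith
    have h3 : 0 < 1 / ((d : ℝ) + 1) := by positivity
    nlinarith
  have hC : depthConstant d - 1 = v / (1 - v) := by
    rw [depthConstant, logb_inv_splitRatio, ← hv]
    have : (1 - v) ≠ 0 := by linarith
    field_simp
    ring
  have hlog : 1 ≤ Real.log d := by
    rw [Real.le_log_iff_exp_le (by linarith)]
    linarith [Real.exp_one_lt_d9]
  rw [hC, Real.norm_of_nonneg (div_nonneg hv0 (by linarith)), Real.norm_of_nonneg (by positivity)]
  calc v / (1 - v) ≤ v / (1 / 2) := by gcongr; linarith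
    _ = 2 * v := by ring
    _ ≤ 2 * (1 / (d * Real.log 2)) := by gcongr
    _ = 2 / Real.log 2 * (1 / d) := by field_simp
    _ ≤ _ := by gcongr

/-! ### The depth is below `(C(d) + ε) log₂ n` with high probability -/

theorem mainTheorem3 :
    ∃ C : ℕ → ℝ,
      (∀ d : ℕ, 1 ≤ d → ∀ ε : ℝ, 0 < ε →
        -- the mean depth of the data points
        Tendsto (fun n : ℕ =>
          ⨆ (S : Finset (EuclideanSpace ℝ (Fin d))) (_ : S.card = n) (_ : InGeneralPosition S),
            (randomHyperplaneTree S).toOuterMeasure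
              {T | (C d + ε) * Real.logb 2 (n : ℝ) ≤ T.meanDepth S})
          atTop (𝓝 0) ∧
        -- the depth of a uniformly random data point
        Tendsto (fun n : ℕ =>
          ⨆ (S : Finset (EuclideanSpace ℝ (Fin d))) (_ : S.card = n) (_ : InGeneralPosition S),
            (randomPointDepth S).toOuterMeasure
              {k | (C d + ε) * Real.logb 2 (n : ℝ) ≤ (k : ℝ)})
          atTop (𝓝 0)) ∧
      (fun d : ℕ => C d - 1) =O[atTop] (fun d : ℕ => Real.log (d : ℝ) / (d : ℝ)) := by
  refine ⟨depthConstant, fun d hd ε hε => ?_, depthConstant_sub_one_isBigO⟩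
  have hC := depthConstant_pos hd
  have hl2 : 0 < Real.log 2 := Real.log_pos (by norm_num)
  -- Any `s / log 2` strictly between `1 / (C + ε)` and `1 / C` works: the lower bound makes the
  -- tail bound `A * n ^ (1 - (C + ε) * s / log 2)` tend to `0`, the upper one makes `A` finite.
  set s : ℝ := Real.log 2 / (depthConstant d + ε / 2) with hs
  have hs0 : 0 ≤ s := by positivity
  have hsq : Real.exp s * splitRatio d < 1 := by
    have hq := splitRatio_pos d
    rw [← lt_div_iff₀ hq, one_div, ← Real.lt_log_iff_exp_lt (inv_pos.2 hq)]
    have h1 : Real.log (splitRatio d)⁻¹ = Real.log 2 / depthConstant d := by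
      rw [depthConstant, div_inv_eq_mul, Real.logb, mul_div_cancel₀ _ hl2.ne']
    rw [h1, hs]
    gcongr
    linarith
  set A : ℝ := d / (1 - Real.exp s * splitRatio d)
  set δ : ℝ := (depthConstant d + ε) / (depthConstant d + ε / 2) - 1 with hδ
  have hδ0 : 0 < δ := by
    rw [hδ, sub_pos, one_lt_div (by positivity)]
    linarith
  have hrate : ∀ n : ℕ, 1 ≤ n →
      n * Real.exp (-(s * ((depthConstant d + ε) * Real.logb 2 n))) = (n : ℝ) ^ (-δ) := by
    intro n hn
    have hn0 : (0 : ℝ) < n := by exact_mod_cast hn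
    have e : s * ((depthConstant d + ε) * Real.logb 2 n) = (1 + δ) * Real.log n := by
      rw [hs, hδ, Real.logb]
      field_simp
      ring
    rw [e, Real.rpow_def_of_pos hn0]
    conv_lhs => rw [← Real.exp_log hn0]
    rw [← Real.exp_add, Real.exp_log hn0]
    ring_nf
  have hlim : Tendsto (fun n : ℕ => ENNReal.ofReal (A * (n : ℝ) ^ (-δ))) atTop (𝓝 0) := by
    have h := ((tendsto_rpow_neg_atTop hδ0).comp tendsto_natCast_atTop_atTop).const_mul A
    rw [mul_zero] at h
    simpa using ENNReal.tendsto_ofReal h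
  constructor
  · refine tendsto_of_tendsto_of_tendsto_of_le_of_le' tendsto_const_nhds hlim
      (Eventually.of_forall fun _ => zero_le) ?_
    filter_upwards [eventually_ge_atTop 1] with n hn
    refine iSup_le fun S => iSup_le fun hcard => iSup_le fun hS => ?_
    have hne : S.Nonempty := Finset.card_pos.1 (by omega)
    have h := prob_meanDepth_le hd hs0 hsq hne hS ((depthConstant d + ε) * Real.logb 2 n)
    rwa [hcard, hrate n hn] at h
  · refine tendsto_of_tendsto_of_tendsto_of_le_of_le' tendsto_const_nhds hlim
      (Eventually.of_forall fun _ => zero_le) ?_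
    filter_upwards [eventually_ge_atTop 1] with n hn
    refine iSup_le fun S => iSup_le fun hcard => iSup_le fun hS => ?_
    have hne : S.Nonempty := Finset.card_pos.1 (by omega)
    have h := prob_randomPointDepth_le hd hs0 hsq hne hS
      ((depthConstant d + ε) * Real.logb 2 n)
    rwa [hcard, hrate n hn] at h
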